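/- Let $\mathcal X$ be a measurable space and, for $f:\mathcal X\to\mathbb R$, put $G_f=\{x: f(x)\ge 0\}$ and $\operatorname{sign}(a)=1$ for $a\ge 0$, $\operatorname{sign}(a)=-1$ for $a<0$. For a probability distribution $P$ of $(Y,X)$ on $\{-1,1\}\times\mathcal X$ with $X$-marginal $P_X$, let $R(f)=P\big(Y\operatorname{sign}(f(X))\le 0\big)$ be the classification risk; for a sample $(Y_i,X_i)_{i\le n}$, $n\ge 1$, let $\hat R_{\phi_h}(f)=\frac1n\sum_{i=1}^n\max\{0,1-Y_if(X_i)\}$ be the empirical hinge risk. Let $\mathcal G$ be a class of measurable subsets of $\mathcal X$, let $\mathcal F_{\mathcal G}=\{f: G_f\in\mathcal G,\ f(\cdot)\in[-1,1]\}$, and let $\widetilde{\mathcal F}_{\mathcal G}\subseteq\mathcal F_{\mathcal G}$ satisfy (A1) either $\{x: f(x)\ge t\}\in\mathcal G$ for all $f\in\widetilde{\mathcal F}_{\mathcal G}$ and $t\in[-1,1]$, or $\{x: f(x)\le t\}\in\mathcal G$ for all $f\in\widetilde{\mathcal F}_{\mathcal G}$ and $t\in[-1,1]$; (A2) for every $G\in\mathcal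 G$, the step function $2\cdot 1\{x\in G\}-1$ belongs to $\widetilde{\mathcal F}_{\mathcal G}$. For a class $\mathcal F$ of functions on $\mathcal X$, let $N_1^B(\epsilon,\mathcal F,P_X)$ be the smallest $k$ for which there are pairs of measurable functions $f_j^L\le f_j^U$, $j=1,\dots,k$, with $\int|f_j^U-f_j^L|\,dP_X<\epsilon$ such that every $f\in\mathcal F$ satisfies $f_j^L\le f\le f_j^U$ for some $j$; let $H_1^B(\epsilon,\mathcal F,P_X)=\log N_1^B(\epsilon,\mathcal F,P_X)$, and let $H_1^B(\epsilon,\mathcal G,P_X)$ be that of the class of indicator functions of the sets in $\mathcal G$. Let $C,r>0$ and let $\mathcal P$ be a class of distributions on $\{-1,1\}\times\mathcal X$ such that $$H_1^B(\epsilon,\mathcal G,P_X)\le C\epsilon^{-r}\ \text{ for all } P\in\mathcal P,\ \epsilon>0,\qquad\text{or}\qquad H_1^B(\epsilon,\widetilde{\mathcal F}_{\mathcal G},P_X)\le C\epsilon^{-r}\ \text{ for all } P\in\mathcal P,\ \epsilon>0.$$ Define $\tau_n=n^{-1/2}$ if $r<1$, $\tau_n=\log(n)/\sqrt n$ if $r=1$,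 $\tau_n=n^{-1/(r+1)}$ if $r>1$, and $q_n=\sqrt n\,\tau_n$. Let $\hat f$ minimize $\hat R_{\phi_h}$ over $\widetilde{\mathcal F}_{\mathcal G}$, computed from an i.i.d. sample of size $n$ from $P$. Then $$\sup_{P\in\mathcal P}E_{P^n}\Big[R(\hat f)-\inf_{f\in\mathcal F_{\mathcal G}}R(f)\Big]\le L_C(r,n),\qquad L_C(r,n)=\begin{cases}2D_1\tau_n+4D_2\exp(-D_1^2q_n^2)&\text{if } r\ge 1,\\ 2D_3\tau_n+2n^{-1}D_4&\text{if } r<1,\end{cases}$$ for some positive constants $D_1,D_2,D_3,D_4$ that depend only on $C$ and $r$. -/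

import Mathlib

open MeasureTheory
open scoped ENNReal

universe u

noncomputable section

namespace ConstrainedClassification

/-- The label set `{-1, 1}`. -/
abbrev Label : Type := ({-1, 1} : Set ℝ)

/-- The sign convention of the classification problem: `sgn 0 = 1`. -/
def sgn (a : ℝ) : ℝ := if 0 ≤ a then 1 else -1

/-- The prediction set `G_f = {x : f x ≥ 0}` of a classifier. -/
def predictionSet {𝒳 : Type u} (f : 𝒳 → ℝ) : Set 𝒳 := {x | 0 ≤ f x}

/-- The class `F_𝒢` of all classifiers with values in `[-1, 1]` whose prediction set lies in `𝒢`. -/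
def constrainedClass {𝒳 : Type u} (𝒢 : Set (Set 𝒳)) : Set (𝒳 → ℝ) :=
  {f | predictionSet f ∈ 𝒢 ∧ ∀ x, f x ∈ Set.Icc (-1 : ℝ) 1}

/-- The indicator function of `G`. -/
def indicatorFn {𝒳 : Type u} (G : Set 𝒳) : 𝒳 → ℝ := G.indicator (fun _ => (1 : ℝ))

/-- The step classifier `2 · 1{x ∈ G} - 1`. -/
def stepClassifier {𝒳 : Type u} (G : Set 𝒳) : 𝒳 → ℝ := fun x => 2 * indicatorFn G x - 1

/-- The classification risk `R(f) = P (Y · sgn (f X) ≤ 0)`. -/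
def risk {𝒳 : Type u} [MeasurableSpace 𝒳] (P : Measure (Label × 𝒳)) (f : 𝒳 → ℝ) : ℝ :=
  P.real {z | (z.1 : ℝ) * sgn (f z.2) ≤ 0}

/-- The optimal risk over the constrained class, `inf {R(f) : f ∈ F_𝒢}`. -/
def optimalRisk {𝒳 : Type u} [MeasurableSpace 𝒳] (P : Measure (Label × 𝒳))
    (𝒢 : Set (Set 𝒳)) : ℝ :=
  sInf (risk P '' constrainedClass 𝒢)

/-- The `𝒢`-constrained excess classification risk of `f`. -/
def excessRisk {𝒳 : Type u} [MeasurableSpace 𝒳] (P : Measure (Label × 𝒳))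
    (𝒢 : Set (Set 𝒳)) (f : 𝒳 → ℝ) : ℝ :=
  risk P f - optimalRisk P 𝒢

/-- The joint distribution `P^n` of an i.i.d. sample of size `n`. -/
def sampleLaw {𝒳 : Type u} [MeasurableSpace 𝒳] (P : Measure (Label × 𝒳)) (n : ℕ) :
    Measure (Fin n → Label × 𝒳) :=
  Measure.pi fun _ => P

/-- The empirical hinge risk `(1/n) ∑ i, max {0, 1 - Y i * f (X i)}` of a sample. -/
def empiricalHingeRisk {𝒳 : Type u} {n : ℕ} (z : Fin n → Label × 𝒳) (f : 𝒳 → ℝ) : ℝ :=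
  (1 / (n : ℝ)) * ∑ i, max 0 (1 - ((z i).1 : ℝ) * f (z i).2)

/-- `F` is covered by `k` brackets `[l j, h j]` of `L_p(Q)`-size less than `ε`. The end points of
the brackets are measurable and need not belong to `F`. -/
def HasBracketCover {𝒳 : Type u} [MeasurableSpace 𝒳] (p : ℝ≥0∞) (ε : ℝ) (F : Set (𝒳 → ℝ))
    (Q : Measure 𝒳) (k : ℕ) : Prop :=
  ∃ l h : Fin k → 𝒳 → ℝ,
    (∀ j, Measurable (l j) ∧ Measurable (h j) ∧ l j ≤ h j ∧
      eLpNorm (h j - l j) p Q < ENNReal.ofReal ε) ∧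
    ∀ f ∈ F, ∃ j, l j ≤ f ∧ f ≤ h j

/-- The `L_p(Q)`-bracketing number: the smallest number of brackets that cover `F`
(infinite if there is no finite cover). -/
def bracketingNumber {𝒳 : Type u} [MeasurableSpace 𝒳] (p : ℝ≥0∞) (ε : ℝ) (F : Set (𝒳 → ℝ))
    (Q : Measure 𝒳) : ℕ∞ :=
  ⨅ (k : ℕ) (_ : HasBracketCover p ε F Q k), (k : ℕ∞)

/-- The `L_p(Q)`-bracketing entropy of a class of functions: the logarithm of the bracketing
number, as an extended real number. -/
def bracketingEntropy {𝒳 : Type u} [MeasurableSpace 𝒳] (p : ℝ≥0∞) (ε : ℝ) (F : Set (𝒳 → ℝ))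
    (Q : Measure 𝒳) : EReal :=
  ENNReal.log ((bracketingNumber p ε F Q : ℕ∞) : ℝ≥0∞)

/-- The `L_p(Q)`-bracketing entropy of a class of sets: that of its indicator functions. -/
def bracketingEntropySets {𝒳 : Type u} [MeasurableSpace 𝒳] (p : ℝ≥0∞) (ε : ℝ)
    (𝒢 : Set (Set 𝒳)) (Q : Measure 𝒳) : EReal :=
  bracketingEntropy p ε (indicatorFn '' 𝒢) Q

/-- The rate `τ_n`. -/
def rateTau (r : ℝ) (n : ℕ) : ℝ :=
  if r < 1 then (n : ℝ) ^ (-(1 / 2) : ℝ)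
  else if r = 1 then Real.log n / Real.sqrt n
  else (n : ℝ) ^ (-(1 / (r + 1)))

/-- `q_n = √n τ_n`. -/
def rateQ (r : ℝ) (n : ℕ) : ℝ := Real.sqrt n * rateTau r n

/-- The bound `L_C(r, n)` with constants `D₁, D₂, D₃, D₄`. -/
def riskBound (D₁ D₂ D₃ D₄ r : ℝ) (n : ℕ) : ℝ :=
  if 1 ≤ r then 2 * D₁ * rateTau r n + 4 * D₂ * Real.exp (-(D₁ ^ 2 * rateQ r n ^ 2))
  else 2 * D₃ * rateTau r n + 2 * (n : ℝ)⁻¹ * D₄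

end ConstrainedClassification

end

open ConstrainedClassification

namespace ConstrainedClassification

/-! For `f` with values in `[-1, 1]` the hinge loss is `1 - Y f(X)`, linear in `f`, so `fhat`
maximizes `∑ Y_i f(X_i)` over `F`. Such an `f` is half the integral over `t ∈ [-1, 1]` of the step
classifiers of `{f ≥ t}`. By (A1) and (A2) each of them, as seen on the sample, is matched by a
member of `F`, hence scores at most as much as `fhat`. Their average equals the score of `fhat`, and
the score is constant in `t` just left of `0`, so level zero is optimal too
(`sum_mul_le_sum_mul_step_zero`). Thus the prediction set of `fhat` minimizes the empirical
classification risk over `𝒢` (`sum_labelledStep_le`), and the excess risk is at most the supremum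
over `G ∈ 𝒢` of the empirical process at `y * (2 * 1{x ∈ G} - 1)` (`risk_sub_risk_le`).

The mean of this supremum is bounded by chaining over brackets of `L₁`-size `4 ^ (-k)`
(`exists_majorant_class`). Bounded functions have variance at most a multiple of their `L₁` norm, so
with entropy of order `4 ^ (r * k)` link `k` costs about `2 ^ ((r - 1) * k) / √n`. The chain stops
at the last `K` with `2 ^ ((r + 1) * K) ≤ √n`, where the remaining bias `4 ^ (-K)` is about `n ^ (-1
/ (r + 1))`. The geometric sum converges for `r < 1`, has about `log n` equal terms for `r = 1`, and
is dominated by its last term for `r > 1`, which gives the three rates.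

The supremum need not be measurable, so every bound is carried by an integrable majorant `W`. -/

/-- The deviation `P_n g - P g` of an empirical mean from its expectation. -/
noncomputable def empDev {Ω : Type u} [MeasurableSpace Ω] (P : Measure Ω) {n : ℕ} (z : Fin n → Ω)
    (g : Ω → ℝ) : ℝ :=
  (1 / (n : ℝ)) * ∑ i, g (z i) - ∫ w, g w ∂P

/-! ### Bernstein-type maximal inequality for finitely many functions -/

section MaximalInequality

variable {Ω : Type u} [MeasurableSpace Ω] {P : Measure Ω}

theorem measurable_empDev {n : ℕ} {g : Ω → ℝ} (hg : Measurable g) :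
    Measurable fun z : Fin n → Ω => empDev P z g := by
  unfold empDev
  fun_prop

theorem exp_le_one_add_add_sq {x : ℝ} (hx : |x| ≤ 1) : Real.exp x ≤ 1 + x + x ^ 2 := by
  have := Real.abs_exp_sub_one_sub_id_le hx
  linarith [le_abs_self (Real.exp x - 1 - x)]

variable [IsProbabilityMeasure P]

theorem integrable_of_abs_le {g : Ω → ℝ} {M : ℝ} (hg : Measurable g) (hb : ∀ w, |g w| ≤ M) :
    Integrable g P :=
  Integrable.of_bound hg.aestronglyMeasurable M (ae_of_all _ fun w => by simpa using hb w)

/-- Bernstein-type bound on the moment generating function of a centred bounded variable. -/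
theorem integral_exp_centered_le {g : Ω → ℝ} {v lam : ℝ} (hg : Measurable g)
    (hb : ∀ w, |g w| ≤ 2) (hv : ∫ w, |g w| ∂P ≤ v) (hlam : |lam| ≤ 1 / 4) :
    ∫ w, Real.exp (lam * (g w - ∫ w, g w ∂P)) ∂P ≤ Real.exp (2 * lam ^ 2 * v) := by
  set m := ∫ w, g w ∂P with hm
  have hgi : Integrable g P := integrable_of_abs_le hg hb
  have hmb : |m| ≤ 2 := by
    calc |m| ≤ ∫ w, |g w| ∂P := abs_integral_le_integral_abs
      _ ≤ ∫ _, (2 : ℝ) ∂P := integral_mono hgi.abs (integrable_const _) hb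
      _ = 2 := by simp
  have hg2 : Integrable (fun w => g w ^ 2) P :=
    integrable_of_abs_le (M := 4) (hg.pow_const 2) fun w => by
      rw [abs_pow]; nlinarith [hb w, abs_nonneg (g w)]
  have hx : ∀ w, |lam * (g w - m)| ≤ 1 := fun w => by
    have h1 : |g w - m| ≤ 4 := (abs_sub _ _).trans (by linarith [hb w])
    rw [abs_mul]
    nlinarith [abs_nonneg lam, abs_nonneg (g w - m)]
  -- Boundedness turns an `L₁` bound into a variance bound; this is why `L₁` brackets suffice.
  have hq : ∫ w, g w ^ 2 ∂P ≤ 2 * v := by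
    calc ∫ w, g w ^ 2 ∂P ≤ ∫ w, 2 * |g w| ∂P := by
          refine integral_mono hg2 (hgi.abs.const_mul 2) fun w => ?_
          change g w ^ 2 ≤ 2 * |g w|
          rw [← sq_abs]; nlinarith [hb w, abs_nonneg (g w)]
      _ ≤ 2 * v := by rw [integral_const_mul]; linarith
  have hexp : Integrable (fun w => Real.exp (lam * (g w - m))) P :=
    integrable_of_abs_le (M := Real.exp 1) (by fun_prop) fun w => by
      rw [abs_of_pos (Real.exp_pos _)]
      exact Real.exp_le_exp.2 ((le_abs_self _).trans (hx w))
  have hlin : Integrable (fun w => lam * (g w - m)) P :=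
    (hgi.sub (integrable_const m)).const_mul lam
  have hsq : Integrable (fun w => (lam * (g w - m)) ^ 2) P :=
    integrable_of_abs_le (M := 1) (by fun_prop) fun w => by
      rw [abs_pow]; nlinarith [hx w, abs_nonneg (lam * (g w - m))]
  have haff : Integrable (fun w => (1 - lam * m + lam ^ 2 * m ^ 2)
      + (lam - 2 * lam ^ 2 * m) * g w) P := (integrable_const _).add (hgi.const_mul _)
  calc ∫ w, Real.exp (lam * (g w - m)) ∂P
      ≤ ∫ w, (1 + lam * (g w - m) + (lam * (g w - m)) ^ 2) ∂P :=
        integral_mono hexp (((integrable_const _).add hlin).add hsq)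
          fun w => exp_le_one_add_add_sq (hx w)
    _ = ∫ w, ((1 - lam * m + lam ^ 2 * m ^ 2) + (lam - 2 * lam ^ 2 * m) * g w
          + lam ^ 2 * g w ^ 2) ∂P := by congr 1; ext w; ring
    _ = (1 - lam * m + lam ^ 2 * m ^ 2) + (lam - 2 * lam ^ 2 * m) * m
          + lam ^ 2 * ∫ w, g w ^ 2 ∂P := by
        rw [integral_add haff (hg2.const_mul _),
          integral_add (integrable_const _) (hgi.const_mul _), integral_const_mul,
          integral_const_mul]
        simp [hm]
    _ ≤ 2 * lam ^ 2 * v + 1 := by nlinarith [sq_nonneg lam, sq_nonneg (lam * m)]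
    _ ≤ Real.exp (2 * lam ^ 2 * v) := Real.add_one_le_exp _

theorem abs_empDev_le {n : ℕ} {g : Ω → ℝ} {M : ℝ} (hg : Measurable g) (hb : ∀ w, |g w| ≤ M)
    (hM : 0 ≤ M) (z : Fin n → Ω) : |empDev P z g| ≤ 2 * M := by
  have h1 : |∫ w, g w ∂P| ≤ M := by
    calc |∫ w, g w ∂P| ≤ ∫ w, |g w| ∂P := abs_integral_le_integral_abs
      _ ≤ ∫ _, M ∂P := integral_mono (integrable_of_abs_le hg hb).abs (integrable_const _) hb
      _ = M := by simp
  have h2 : |(1 / (n : ℝ)) * ∑ i, g (z i)| ≤ M := by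
    rw [abs_mul, abs_of_nonneg (by positivity : (0 : ℝ) ≤ 1 / n)]
    have h3 : |∑ i, g (z i)| ≤ n * M := by
      refine (Finset.abs_sum_le_sum_abs _ _).trans ?_
      simpa using Finset.sum_le_sum fun i (_ : i ∈ Finset.univ) => hb (z i)
    rcases Nat.eq_zero_or_pos n with rfl | hn
    · simpa using hM
    · rw [one_div, inv_mul_le_iff₀ (by positivity)]
      exact h3
  exact (abs_sub _ _).trans (by linarith)

theorem integral_exp_empDev_le {n : ℕ} (hn : 1 ≤ n) {g : Ω → ℝ} {v lam : ℝ} (hg : Measurable g)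
    (hb : ∀ w, |g w| ≤ 2) (hv : ∫ w, |g w| ∂P ≤ v) (hlam : |lam| ≤ 1 / 4) :
    ∫ z : Fin n → Ω, Real.exp (lam * n * empDev P z g) ∂(Measure.pi fun _ => P)
      ≤ Real.exp (n * (2 * lam ^ 2 * v)) := by
  have hn0 : (n : ℝ) ≠ 0 := by positivity
  have key : ∀ z : Fin n → Ω, Real.exp (lam * n * empDev P z g)
      = ∏ i, Real.exp (lam * (g (z i) - ∫ w, g w ∂P)) := fun z => by
    rw [← Real.exp_sum, ← Finset.mul_sum, Finset.sum_sub_distrib]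
    simp only [empDev, Finset.sum_const, Finset.card_univ, Fintype.card_fin, nsmul_eq_mul]
    congr 1
    field_simp
  simp_rw [key]
  rw [integral_fintype_prod_eq_prod (fun _ w => Real.exp (lam * (g w - ∫ w, g w ∂P)))]
  rw [Finset.prod_const, Finset.card_univ, Fintype.card_fin, Real.exp_nat_mul]
  exact pow_le_pow_left₀ (integral_nonneg fun _ => (Real.exp_pos _).le)
    (integral_exp_centered_le hg hb hv hlam) n

/-- A maximal inequality for finitely many empirical means, with a measurable majorant. -/
theorem exists_majorant_empDev {n : ℕ} (hn : 1 ≤ n) {ι : Type*} [Fintype ι] {g : ι → Ω → ℝ}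
    {v lam H : ℝ} (hg : ∀ i, Measurable (g i)) (hb : ∀ i w, |g i w| ≤ 2)
    (hv : ∀ i, ∫ w, |g i w| ∂P ≤ v) (hlam : 0 < lam) (hlam' : lam ≤ 1 / 4)
    (hH : 2 * (Fintype.card ι : ℝ) ≤ Real.exp H) :
    ∃ W : (Fin n → Ω) → ℝ, Integrable W (Measure.pi fun _ => P) ∧
      (∀ z i, |empDev P z (g i)| ≤ W z) ∧
      ∫ z, W z ∂(Measure.pi fun _ => P) ≤ H / (n * lam) + 2 * lam * v := by
  have hn0 : (0 : ℝ) < n := by positivity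
  have hs : 0 < lam * n := by positivity
  set b : ℝ := n * (2 * lam ^ 2 * v) with hbdef
  set S : (Fin n → Ω) → ℝ := fun z => ∑ i, (Real.exp (lam * n * empDev P z (g i))
    + Real.exp (-lam * n * empDev P z (g i))) with hS
  have hint : ∀ (c : ℝ) i,
      Integrable (fun z : Fin n → Ω => Real.exp (c * empDev P z (g i)))
        (Measure.pi fun _ => P) := fun c i => by
    refine integrable_of_abs_le (M := Real.exp (|c| * 4)) ?_ fun z => ?_
    · exact Real.measurable_exp.comp ((measurable_empDev (hg i)).const_mul c)
    · rw [abs_of_pos (Real.exp_pos _)]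
      refine Real.exp_le_exp.2 ((le_abs_self _).trans ?_)
      rw [abs_mul]
      have := abs_empDev_le (P := P) (hg i) (hb i) (by norm_num) z
      exact mul_le_mul_of_nonneg_left (by linarith) (abs_nonneg c)
  have hSi : Integrable S (Measure.pi fun _ => P) :=
    integrable_finsetSum _ fun i _ => (hint _ i).add (hint _ i)
  have hSle : ∫ z, S z ∂(Measure.pi fun _ => P) ≤ Real.exp (H + b) := by
    have hadd : ∀ i, Integrable (fun z : Fin n → Ω => Real.exp (lam * n * empDev P z (g i))
        + Real.exp (-lam * n * empDev P z (g i))) (Measure.pi fun _ => P) :=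
      fun i => (hint _ i).add (hint _ i)
    simp only [hS]
    rw [integral_finsetSum _ fun i _ => hadd i]
    calc _ ≤ ∑ _i : ι, 2 * Real.exp b := by
          refine Finset.sum_le_sum fun i _ => ?_
          rw [integral_add (hint _ i) (hint _ i)]
          have h1 := integral_exp_empDev_le hn (hg i) (hb i) (hv i)
            (by rwa [abs_of_pos hlam] : |lam| ≤ 1 / 4)
          have h2 := integral_exp_empDev_le hn (hg i) (hb i) (hv i)
            (by rwa [abs_neg, abs_of_pos hlam] : |-lam| ≤ 1 / 4)
          rw [neg_sq] at h2
          linarith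
      _ = 2 * (Fintype.card ι : ℝ) * Real.exp b := by
          rw [Finset.sum_const, Finset.card_univ, nsmul_eq_mul]; ring
      _ ≤ Real.exp (H + b) := by
          rw [Real.exp_add]; exact mul_le_mul_of_nonneg_right hH (Real.exp_pos b).le
  -- The majorant is the tangent line of `log` at `exp (H + b)`, evaluated at `S` and divided by
  -- `lam * n`. Being affine in `S`, it is integrable and needs only the bound on the mean of `S`.
  refine ⟨fun z => (lam * n)⁻¹ * (S z * (Real.exp (H + b))⁻¹ + (H + b - 1)), ?_, ?_, ?_⟩
  · exact ((hSi.mul_const _).add (integrable_const _)).const_mul _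
  · intro z i
    have hle : Real.exp (lam * n * |empDev P z (g i)|) ≤ S z := by
      refine le_trans ?_ (Finset.single_le_sum
        (f := fun i => Real.exp (lam * n * empDev P z (g i))
          + Real.exp (-lam * n * empDev P z (g i)))
        (fun j _ => by positivity) (Finset.mem_univ i))
      rcases abs_cases (empDev P z (g i)) with ⟨h, _⟩ | ⟨h, _⟩ <;> rw [h]
      · linarith [Real.exp_pos (-lam * n * empDev P z (g i))]
      · rw [show lam * n * -empDev P z (g i) = -lam * n * empDev P z (g i) by ring]
        linarith [Real.exp_pos (lam * n * empDev P z (g i))]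
    have h1 := Real.add_one_le_exp (lam * n * |empDev P z (g i)| - (H + b))
    rw [Real.exp_sub, div_eq_mul_inv] at h1
    have h2 := mul_le_mul_of_nonneg_right hle (inv_nonneg.2 (Real.exp_pos (H + b)).le)
    change _ ≤ (lam * n)⁻¹ * (S z * (Real.exp (H + b))⁻¹ + (H + b - 1))
    rw [inv_mul_eq_div, le_div_iff₀ hs]
    linarith
  · rw [integral_const_mul, integral_add (hSi.mul_const _) (integrable_const _),
      integral_mul_const]
    have h1 : (∫ z, S z ∂(Measure.pi fun _ => P)) * (Real.exp (H + b))⁻¹ ≤ 1 := by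
      rw [← div_eq_mul_inv, div_le_one (Real.exp_pos _)]; exact hSle
    have h2 : H / (n * lam) + 2 * lam * v = (lam * n)⁻¹ * (1 + (H + b - 1)) := by
      rw [hbdef]; field_simp; ring
    rw [h2]
    refine mul_le_mul_of_nonneg_left ?_ (inv_nonneg.2 hs.le)
    rw [integral_const, probReal_univ, one_smul]
    linarith

end MaximalInequality

/-! ### Comparison of the chaining bound with `τ_n` -/

/-- The bound produced by chaining down to the scale `4 ^ (-K)`, for brackets of entropy
`A * x ^ (2 * k)` at the scale `4 ^ (-k)`. -/
noncomputable def chainBound (A x : ℝ) (n K : ℕ) : ℝ :=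
  A / Real.sqrt n * (∑ k ∈ Finset.range (K + 1), (x / 2) ^ k + (x / 2) ^ K) + 2 * (1 / 4) ^ K

theorem rpow_neg_inv_le_rateTau {r : ℝ} (hr : 0 < r) {n : ℕ} (hn : 1 ≤ n) (h : r ≠ 1 ∨ 2 ≤ n) :
    (n : ℝ) ^ (-(1 / (r + 1))) ≤ 2 * rateTau r n := by
  have hn1 : (1 : ℝ) ≤ n := by exact_mod_cast hn
  have hpos : 0 < (n : ℝ) ^ (-(1 / (r + 1))) := by positivity
  unfold rateTau
  split_ifs with h1 h2
  · have : (n : ℝ) ^ (-(1 / (r + 1))) ≤ (n : ℝ) ^ (-(1 / 2) : ℝ) := by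
      refine Real.rpow_le_rpow_of_exponent_le hn1 (neg_le_neg ?_)
      exact one_div_le_one_div_of_le (by linarith) (by linarith)
    linarith
  · subst h2
    have hn2 : (2 : ℝ) ≤ n := by exact_mod_cast h.resolve_left (by simp)
    have hlog : 1 / 2 ≤ Real.log n := by
      linarith [Real.log_two_gt_d9, Real.log_le_log (by norm_num) hn2]
    have : (n : ℝ) ^ (-(1 / (1 + 1)) : ℝ) = (Real.sqrt n)⁻¹ := by
      rw [Real.sqrt_eq_rpow, ← Real.rpow_neg (by linarith)]; norm_num
    rw [this, mul_div_assoc', inv_eq_one_div]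
    gcongr
    linarith
  · linarith

/-- The geometric part of the chaining bound is of order `√n * τ_n`. -/
theorem exists_geom_sum_le_rateTau {r : ℝ} (hr : 0 < r) :
    ∃ B : ℝ, 0 < B ∧ ∀ n K : ℕ, 1 ≤ n → (r ≠ 1 ∨ 2 ≤ n) →
      (2 * (2 : ℝ) ^ r) ^ K ≤ Real.sqrt n →
      (∑ k ∈ Finset.range (K + 1), ((2 : ℝ) ^ r / 2) ^ k) / Real.sqrt n ≤ B * rateTau r n := by
  have hq : (2 : ℝ) ^ r / 2 = 2 ^ (r - 1) := by rw [Real.rpow_sub_one (by norm_num)]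
  rw [hq]
  rcases lt_trichotomy r 1 with h | h | h
  · have hq1 : (2 : ℝ) ^ (r - 1) < 1 :=
      Real.rpow_lt_one_of_one_lt_of_neg (by norm_num) (by linarith)
    have hq0 : (0 : ℝ) ≤ 2 ^ (r - 1) := by positivity
    refine ⟨(1 - (2 : ℝ) ^ (r - 1))⁻¹, inv_pos.2 (by linarith), fun n K hn _ _ => ?_⟩
    rw [rateTau, if_pos h, div_eq_mul_inv]
    have : (Real.sqrt n)⁻¹ = (n : ℝ) ^ (-(1 / 2) : ℝ) := by
      rw [Real.sqrt_eq_rpow, ← Real.rpow_neg (by positivity)]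
    rw [this]
    gcongr
    rw [← tsum_geometric_of_lt_one hq0 hq1]
    exact (summable_geometric_of_lt_one hq0 hq1).sum_le_tsum _ fun _ _ => by positivity
  · subst h
    -- All terms equal `1`, and `4 ^ K ≤ √n` bounds their number `K + 1` by a multiple of `log n`.
    refine ⟨3, by norm_num, fun n K hn hn2 hK => ?_⟩
    have hn2 : (2 : ℝ) ≤ n := by exact_mod_cast hn2.resolve_left (by simp)
    have hlog : Real.log 2 ≤ Real.log n := Real.log_le_log (by norm_num) hn2
    have h4 := Real.log_le_log (by positivity) hK
    rw [Real.log_pow, Real.log_sqrt (by linarith), Real.rpow_one,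
      show (2 * 2 : ℝ) = 2 ^ 2 by norm_num, Real.log_pow] at h4
    push_cast at h4
    have hl2 := Real.log_two_gt_d9
    have hK0 : (0 : ℝ) ≤ K := by positivity
    rw [rateTau, if_neg (lt_irrefl _), if_pos rfl, mul_div_assoc']
    gcongr
    simp only [sub_self, Real.rpow_zero, one_pow, Finset.sum_const, Finset.card_range,
      nsmul_eq_mul, mul_one]
    push_cast
    nlinarith
  · have hq1 : 1 < (2 : ℝ) ^ (r - 1) := Real.one_lt_rpow (by norm_num) (by linarith)
    refine ⟨(2 : ℝ) ^ (r - 1) / ((2 : ℝ) ^ (r - 1) - 1),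
      div_pos (by linarith) (by linarith), fun n K hn _ hK => ?_⟩
    have hn0 : (0 : ℝ) < n := by positivity
    -- The last term governs the sum: raise `2 ^ ((r + 1) * K) ≤ √n` to the power `(r - 1) / (r +
    -- 1)`.
    have hqK : ((2 : ℝ) ^ (r - 1)) ^ K ≤ Real.sqrt n * (n : ℝ) ^ (-(1 / (r + 1))) := by
      have e1 : ((2 : ℝ) ^ (r - 1)) ^ K = ((2 * (2 : ℝ) ^ r) ^ K) ^ ((r - 1) / (r + 1)) := by
        rw [show 2 * (2 : ℝ) ^ r = 2 ^ (r + 1) by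
            rw [Real.rpow_add_one (by norm_num)]; ring,
          ← Real.rpow_natCast, ← Real.rpow_natCast, ← Real.rpow_mul (by positivity),
          ← Real.rpow_mul (by positivity), ← Real.rpow_mul (by positivity)]
        congr 1
        field_simp
      have e2 : Real.sqrt n * (n : ℝ) ^ (-(1 / (r + 1)))
          = Real.sqrt n ^ ((r - 1) / (r + 1)) := by
        rw [Real.sqrt_eq_rpow, ← Real.rpow_add hn0, ← Real.rpow_mul hn0.le]
        congr 1
        field_simp
        ring
      rw [e1, e2]
      exact Real.rpow_le_rpow (by positivity) hK (div_nonneg (by linarith) (by linarith))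
    rw [rateTau, if_neg (by linarith), if_neg h.ne', div_le_iff₀ (Real.sqrt_pos.2 hn0),
      geom_sum_eq hq1.ne', mul_assoc, mul_comm _ (Real.sqrt n), div_mul_eq_mul_div]
    refine div_le_div_of_nonneg_right ?_ (by linarith)
    rw [pow_succ]
    nlinarith [mul_le_mul_of_nonneg_left hqK (by linarith : (0 : ℝ) ≤ 2 ^ (r - 1))]

/-- `K` is the largest exponent with `2 ^ ((r + 1) * K) ≤ √n`. Its maximality makes the bias `4 ^
(-K)` at most `4 * n ^ (-1 / (r + 1))`, while the constraint itself controls the geometric sum. At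
`r = 1`, `n = 1` the rate vanishes, hence the exclusion. -/
theorem exists_chainBound_le_rateTau {A r : ℝ} (hA : 0 < A) (hr : 0 < r) :
    ∃ D : ℝ, 0 < D ∧ ∀ n : ℕ, 1 ≤ n → (r ≠ 1 ∨ 2 ≤ n) →
      ∃ K : ℕ, (2 * (2 : ℝ) ^ r) ^ K ≤ Real.sqrt n ∧
        chainBound A (2 ^ r) n K ≤ D * rateTau r n := by
  obtain ⟨B, hB, hgeom⟩ := exists_geom_sum_le_rateTau hr
  refine ⟨2 * A * B + 16, by positivity, fun n hn hrn => ?_⟩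
  have hn0 : (0 : ℝ) < n := by positivity
  have hx : (1 : ℝ) ≤ 2 ^ r := Real.one_le_rpow (by norm_num) hr.le
  obtain ⟨K, hK, hK'⟩ := exists_nat_pow_near (x := Real.sqrt n) (y := 2 * (2 : ℝ) ^ r)
    (Real.one_le_sqrt.2 (by exact_mod_cast hn)) (by linarith)
  refine ⟨K, hK, ?_⟩
  have h1 := hgeom n K hn hrn hK
  have h2 := rpow_neg_inv_le_rateTau hr hn hrn
  have h3 : (1 / 4 : ℝ) ^ K ≤ 4 * (n : ℝ) ^ (-(1 / (r + 1))) := by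
    have e1 : (1 / 4 : ℝ) ^ (K + 1)
        = (((2 * (2 : ℝ) ^ r) ^ (K + 1)) ^ (2 : ℝ)) ^ (-(1 / (r + 1))) := by
      rw [show 2 * (2 : ℝ) ^ r = 2 ^ (r + 1) by rw [Real.rpow_add_one (by norm_num)]; ring,
        show (1 / 4 : ℝ) = 2 ^ (-2 : ℝ) by
          rw [Real.rpow_neg (by norm_num)]; norm_num,
        ← Real.rpow_natCast, ← Real.rpow_natCast, ← Real.rpow_mul (by positivity),
        ← Real.rpow_mul (by positivity), ← Real.rpow_mul (by positivity),
        ← Real.rpow_mul (by positivity)]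
      congr 1
      field_simp
    have e2 : (1 / 4 : ℝ) ^ (K + 1) ≤ (n : ℝ) ^ (-(1 / (r + 1))) := by
      rw [e1]
      refine Real.rpow_le_rpow_of_nonpos hn0 ?_ (neg_nonpos.2 (by positivity))
      calc (n : ℝ) = Real.sqrt n ^ (2 : ℝ) := by
            rw [Real.rpow_two, Real.sq_sqrt hn0.le]
        _ ≤ _ := Real.rpow_le_rpow (Real.sqrt_nonneg _) hK'.le (by norm_num)
    rw [pow_succ] at e2
    linarith
  have h4 : ((2 : ℝ) ^ r / 2) ^ K ≤ ∑ k ∈ Finset.range (K + 1), ((2 : ℝ) ^ r / 2) ^ k :=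
    Finset.single_le_sum (f := fun k => ((2 : ℝ) ^ r / 2) ^ k) (fun k _ => by positivity)
      (Finset.self_mem_range_succ K)
  have h5 : A / Real.sqrt n * (∑ k ∈ Finset.range (K + 1), ((2 : ℝ) ^ r / 2) ^ k
      + ((2 : ℝ) ^ r / 2) ^ K)
      ≤ 2 * A * ((∑ k ∈ Finset.range (K + 1), ((2 : ℝ) ^ r / 2) ^ k) / Real.sqrt n) := by
    calc _ ≤ A / Real.sqrt n * (2 * ∑ k ∈ Finset.range (K + 1), ((2 : ℝ) ^ r / 2) ^ k) := by
          gcongr; linarith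
      _ = _ := by ring
  have h6 := mul_le_mul_of_nonneg_left h1 (by positivity : 0 ≤ 2 * A)
  unfold chainBound
  linarith

/-! ### Chaining with brackets -/

section Chaining

variable {Ω : Type u} [MeasurableSpace Ω] {P : Measure Ω}

/-- The brackets `[L j, U j]` with values in `[-1, 1]` and `L₁(P)`-size at most `ε` cover `𝓕`. -/
def IsBracketing (P : Measure Ω) (𝓕 : Set (Ω → ℝ)) (ε : ℝ) {N : ℕ} (L U : Fin N → Ω → ℝ) : Prop :=
  (∀ j, Measurable (L j) ∧ Measurable (U j) ∧
    (∀ w, |L j w| ≤ 1 ∧ |U j w| ≤ 1 ∧ L j w ≤ U j w) ∧ ∫ w, (U j w - L j w) ∂P ≤ ε) ∧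
  ∀ f ∈ 𝓕, ∃ j, ∀ w, L j w ≤ f w ∧ f w ≤ U j w

theorem empDev_add_sub {n : ℕ} {f g : Ω → ℝ} (hf : Integrable f P) (hg : Integrable g P)
    (z : Fin n → Ω) : empDev P z f = empDev P z (fun w => f w - g w) + empDev P z g := by
  simp only [empDev, Finset.sum_sub_distrib]
  rw [integral_sub hf hg]
  ring

variable [IsProbabilityMeasure P]

/-- The maximal inequality for one link of the chain, at the scale `4 ^ (-k)`. -/
theorem exists_majorant_link {n k K : ℕ} (hn : 1 ≤ n) {C x : ℝ} (hx : 1 ≤ x)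
    (hkK : k ≤ K) (hK : (2 * x) ^ K ≤ Real.sqrt n) {ι : Type*} [Fintype ι] {g : ι → Ω → ℝ}
    (hg : ∀ i, Measurable (g i)) (hb : ∀ i w, |g i w| ≤ 2)
    (hv : ∀ i, ∫ w, |g i w| ∂P ≤ 5 * (1 / 4) ^ k)
    (hcard : (Fintype.card ι : ℝ) ≤ Real.exp (2 * C * (x ^ k) ^ 2)) :
    ∃ W : (Fin n → Ω) → ℝ, Integrable W (Measure.pi fun _ => P) ∧
      (∀ z i, |empDev P z (g i)| ≤ W z) ∧
      ∫ z, W z ∂(Measure.pi fun _ => P) ≤ (8 * C + 7) / Real.sqrt n * (x / 2) ^ k := by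
  have hn0 : (0 : ℝ) < n := by positivity
  have hs : 0 < Real.sqrt n := Real.sqrt_pos.2 hn0
  have hx0 : 0 < x := by linarith
  have hxk : 1 ≤ x ^ k := one_le_pow₀ hx
  have hk : (2 * x) ^ k ≤ Real.sqrt n :=
    (pow_le_pow_right₀ (by linarith) hkK).trans hK
  -- This `lam` makes `H / (n * lam)` and `lam * v` both of order `(x / 2) ^ k / √n`; stopping at
  -- `K` ensures `lam ≤ 1 / 4`. The extra `1` in `H` absorbs the factor `2` for the two signs.
  obtain ⟨W, hW, hle, hint⟩ := exists_majorant_empDev (P := P) hn hg hb hv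
    (lam := (2 * x) ^ k / (4 * Real.sqrt n)) (H := (1 + 2 * C) * (x ^ k) ^ 2) (by positivity)
    (by rw [div_le_div_iff₀ (by positivity) (by norm_num)]; linarith)
    (by
      have h2 : (2 : ℝ) ≤ Real.exp 1 := by linarith [Real.add_one_le_exp 1]
      calc 2 * (Fintype.card ι : ℝ) ≤ Real.exp 1 * Real.exp (2 * C * (x ^ k) ^ 2) := by gcongr
        _ ≤ Real.exp ((1 + 2 * C) * (x ^ k) ^ 2) := by
          rw [← Real.exp_add]
          exact Real.exp_le_exp.2 (by nlinarith))
  refine ⟨W, hW, hle, hint.trans ?_⟩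
  have hsq : (n : ℝ) = Real.sqrt n ^ 2 := (Real.sq_sqrt hn0.le).symm
  have e : (1 + 2 * C) * (x ^ k) ^ 2 / (n * ((2 * x) ^ k / (4 * Real.sqrt n)))
      + 2 * ((2 * x) ^ k / (4 * Real.sqrt n)) * (5 * (1 / 4) ^ k)
      = (8 * C + 13 / 2) / Real.sqrt n * (x / 2) ^ k := by
    rw [show (1 / 4 : ℝ) ^ k = 1 / (2 ^ k) ^ 2 by
        rw [one_div_pow, ← pow_mul, mul_comm, pow_mul]; norm_num,
      mul_pow, div_pow]
    generalize Real.sqrt n = s at *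
    rw [hsq]
    field_simp
    ring
  rw [e]
  gcongr
  norm_num

/-- Induction along lower end points: two brackets of a common `f` at consecutive scales have lower
ends that are `L₁`-close, so `L (k + 1) i` is reached from `L k j` by one of finitely many small
links. -/
theorem exists_majorant_lower {𝓕 : Set (Ω → ℝ)} {n K : ℕ} (hn : 1 ≤ n) {C x : ℝ}
    (hC : 0 < C) (hx : 1 ≤ x) (hK : (2 * x) ^ K ≤ Real.sqrt n) {N : ℕ → ℕ}
    {L U : (k : ℕ) → Fin (N k) → Ω → ℝ} (hLU : ∀ k, IsBracketing P 𝓕 ((1 / 4) ^ k) (L k) (U k))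
    (hN : ∀ k, (N k : ℝ) ≤ Real.exp (C * (x ^ k) ^ 2)) {k : ℕ} (hk : k ≤ K) :
    ∃ W : (Fin n → Ω) → ℝ, Integrable W (Measure.pi fun _ => P) ∧
      (∀ z, ∀ f ∈ 𝓕, ∀ i, (∀ w, L k i w ≤ f w ∧ f w ≤ U k i w) →
        |empDev P z (L k i)| ≤ W z) ∧
      ∫ z, W z ∂(Measure.pi fun _ => P)
        ≤ (8 * C + 7) / Real.sqrt n * ∑ m ∈ Finset.range (k + 1), (x / 2) ^ m := by
  have hLi : ∀ k i, Integrable (L k i) P := fun k i =>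
    integrable_of_abs_le ((hLU k).1 i).1 fun w => (((hLU k).1 i).2.2.1 w).1
  have hUi : ∀ k i, Integrable (U k i) P := fun k i =>
    integrable_of_abs_le ((hLU k).1 i).2.1 fun w => (((hLU k).1 i).2.2.1 w).2.1
  induction k with
  | zero =>
    obtain ⟨W, hW, hle, hint⟩ := exists_majorant_link (P := P) (C := C) (g := L 0) hn hx hk hK
      (fun i => ((hLU 0).1 i).1) (fun i w => by linarith [(((hLU 0).1 i).2.2.1 w).1])
      (fun i => by
        calc ∫ w, |L 0 i w| ∂P ≤ ∫ _, (1 : ℝ) ∂P :=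
              integral_mono (hLi 0 i).abs (integrable_const _)
                fun w => (((hLU 0).1 i).2.2.1 w).1
          _ ≤ 5 * (1 / 4) ^ 0 := by simp)
      (by
        rw [Fintype.card_fin]
        refine (hN 0).trans (Real.exp_le_exp.2 ?_)
        simp only [pow_zero]; linarith)
    exact ⟨W, hW, fun z f _ i _ => hle z i, by simpa using hint⟩
  | succ k ih =>
    obtain ⟨W, hW, hle, hint⟩ := ih (by omega)
    -- Only close pairs are kept; `5 * 4 ^ (-(k + 1))` is the sum of the two bracket sizes.
    let ι := {p : Fin (N (k + 1)) × Fin (N k) //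
      ∫ w, |L (k + 1) p.1 w - L k p.2 w| ∂P ≤ 5 * (1 / 4) ^ (k + 1)}
    have : Fintype ι := Fintype.ofFinite ι
    have hcard : (Fintype.card ι : ℝ) ≤ Real.exp (2 * C * (x ^ (k + 1)) ^ 2) := by
      have h1 : Fintype.card ι ≤ N (k + 1) * N k := by
        calc Fintype.card ι ≤ Fintype.card (Fin (N (k + 1)) × Fin (N k)) :=
              Fintype.card_le_of_injective _ Subtype.val_injective
          _ = _ := by simp
      have hmono : x ^ k ≤ x ^ (k + 1) := pow_le_pow_right₀ hx (by omega)
      have h0 : 0 ≤ x ^ k := by positivity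
      calc (Fintype.card ι : ℝ) ≤ N (k + 1) * N k := by exact_mod_cast h1
        _ ≤ Real.exp (C * (x ^ (k + 1)) ^ 2) * Real.exp (C * (x ^ (k + 1)) ^ 2) := by
          refine mul_le_mul (hN _) ((hN k).trans (Real.exp_le_exp.2 ?_)) (by positivity)
            (Real.exp_pos _).le
          gcongr
        _ = _ := by rw [← Real.exp_add]; ring_nf
    obtain ⟨V, hV, hVle, hVint⟩ := exists_majorant_link (P := P) (C := C)
      (g := fun (p : ι) w => L (k + 1) p.1.1 w - L k p.1.2 w) hn hx hk hK
      (fun p => ((hLU _).1 _).1.sub ((hLU _).1 _).1)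
      (fun p w => (abs_sub _ _).trans (by
        linarith [(((hLU (k + 1)).1 p.1.1).2.2.1 w).1, (((hLU k).1 p.1.2).2.2.1 w).1]))
      (fun p => p.2) hcard
    refine ⟨fun z => V z + W z, hV.add hW, fun z f hf i hi => ?_, ?_⟩
    · obtain ⟨j, hj⟩ := (hLU k).2 f hf
      have hij : ∫ w, |L (k + 1) i w - L k j w| ∂P ≤ 5 * (1 / 4) ^ (k + 1) := by
        calc ∫ w, |L (k + 1) i w - L k j w| ∂P
            ≤ ∫ w, ((U (k + 1) i w - L (k + 1) i w) + (U k j w - L k j w)) ∂P := by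
              refine integral_mono ((hLi _ _).sub (hLi _ _)).abs
                (((hUi _ _).sub (hLi _ _)).add ((hUi _ _).sub (hLi _ _))) fun w => ?_
              obtain ⟨h1, h2⟩ := hi w
              obtain ⟨h3, h4⟩ := hj w
              exact abs_le.2 ⟨by linarith, by linarith⟩
          _ = ∫ w, (U (k + 1) i w - L (k + 1) i w) ∂P + ∫ w, (U k j w - L k j w) ∂P :=
              integral_add ((hUi _ _).sub (hLi _ _)) ((hUi _ _).sub (hLi _ _))
          _ ≤ (1 / 4) ^ (k + 1) + (1 / 4) ^ k :=
              add_le_add ((hLU (k + 1)).1 i).2.2.2 ((hLU k).1 j).2.2.2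
          _ = 5 * (1 / 4) ^ (k + 1) := by ring
      rw [empDev_add_sub (hLi (k + 1) i) (hLi k j)]
      exact (abs_add_le _ _).trans (add_le_add (hVle z ⟨(i, j), hij⟩) (hle z f hf j hj))
    · rw [integral_add hV hW, Finset.sum_range_succ, mul_add]
      linarith

/-- Chaining: an integrable majorant of the empirical process over a class with brackets of
entropy `C * x ^ (2 * k)` at the scales `4 ^ (-k)`. -/
theorem exists_majorant_class {𝓕 : Set (Ω → ℝ)} (hmeas : ∀ f ∈ 𝓕, Measurable f)
    {n K : ℕ} (hn : 1 ≤ n) {C x : ℝ}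
    (hC : 0 < C) (hx : 1 ≤ x) (hK : (2 * x) ^ K ≤ Real.sqrt n) {N : ℕ → ℕ}
    {L U : (k : ℕ) → Fin (N k) → Ω → ℝ} (hLU : ∀ k, IsBracketing P 𝓕 ((1 / 4) ^ k) (L k) (U k))
    (hN : ∀ k, (N k : ℝ) ≤ Real.exp (C * (x ^ k) ^ 2)) :
    ∃ W : (Fin n → Ω) → ℝ, Integrable W (Measure.pi fun _ => P) ∧
      (∀ z, ∀ f ∈ 𝓕, |empDev P z f| ≤ W z) ∧
      ∫ z, W z ∂(Measure.pi fun _ => P) ≤ chainBound (8 * C + 7) x n K := by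
  have hLi : ∀ i, Integrable (L K i) P := fun i =>
    integrable_of_abs_le ((hLU K).1 i).1 fun w => (((hLU K).1 i).2.2.1 w).1
  have hUi : ∀ i, Integrable (U K i) P := fun i =>
    integrable_of_abs_le ((hLU K).1 i).2.1 fun w => (((hLU K).1 i).2.2.1 w).2.1
  obtain ⟨W, hW, hle, hint⟩ := exists_majorant_lower hn hC hx hK hLU hN le_rfl
  obtain ⟨V, hV, hVle, hVint⟩ := exists_majorant_link (P := P) (C := C)
    (g := fun i w => U K i w - L K i w) hn hx (le_refl K) hK
    (fun i => ((hLU K).1 i).2.1.sub ((hLU K).1 i).1)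
    (fun i w => (abs_sub _ _).trans (by
      linarith [(((hLU K).1 i).2.2.1 w).1, (((hLU K).1 i).2.2.1 w).2.1]))
    (fun i => by
      have h : ∀ w, |U K i w - L K i w| = U K i w - L K i w := fun w =>
        abs_of_nonneg (sub_nonneg.2 (((hLU K).1 i).2.2.1 w).2.2)
      simp_rw [h]
      have : (0 : ℝ) ≤ (1 / 4) ^ K := by positivity
      linarith [((hLU K).1 i).2.2.2])
    (by
      rw [Fintype.card_fin]
      refine (hN K).trans (Real.exp_le_exp.2 ?_)
      have : 0 ≤ C * (x ^ K) ^ 2 := by positivity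
      linarith)
  refine ⟨fun z => W z + V z + 2 * (1 / 4) ^ K, (hW.add hV).add (integrable_const _),
    fun z f hf => ?_, ?_⟩
  · obtain ⟨i, hi⟩ := (hLU K).2 f hf
    have hfi : Integrable f P := integrable_of_abs_le (M := 1) (hmeas f hf) fun w => by
      have h1 := (((hLU K).1 i).2.2.1 w).1
      have h2 := (((hLU K).1 i).2.2.1 w).2.1
      exact abs_le.2 ⟨by linarith [(abs_le.1 h1).1, (hi w).1],
        by linarith [(abs_le.1 h2).2, (hi w).2]⟩
    -- Monotonicity replaces `f - L` by the bracket width at the cost of its mean. The factor `2`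
    -- serves the lower bound, since the deviation of the width may itself be as low as `-4 ^ (-K)`.
    have hlast : |empDev P z (fun w => f w - L K i w)|
        ≤ empDev P z (fun w => U K i w - L K i w) + 2 * (1 / 4) ^ K := by
      have hsize := ((hLU K).1 i).2.2.2
      have h1 : ∑ m, (f (z m) - L K i (z m)) ≤ ∑ m, (U K i (z m) - L K i (z m)) :=
        Finset.sum_le_sum fun m _ => by linarith [(hi (z m)).2]
      have h2 : 0 ≤ ∑ m, (f (z m) - L K i (z m)) :=
        Finset.sum_nonneg fun m _ => by linarith [(hi (z m)).1]
      have h3 : ∫ w, (f w - L K i w) ∂P ≤ ∫ w, (U K i w - L K i w) ∂P :=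
        integral_mono (hfi.sub (hLi i)) ((hUi i).sub (hLi i)) fun w => by
          change f w - L K i w ≤ U K i w - L K i w
          linarith [(hi w).2]
      have h4 : 0 ≤ ∫ w, (f w - L K i w) ∂P :=
        integral_nonneg fun w => sub_nonneg.2 (hi w).1
      have hc : (0 : ℝ) ≤ 1 / n := by positivity
      have h5 := mul_le_mul_of_nonneg_left h1 hc
      have h6 := mul_nonneg hc h2
      simp only [empDev]
      exact abs_le.2 ⟨by linarith, by linarith⟩
    rw [empDev_add_sub hfi (hLi i)]
    have h1 := abs_add_le (empDev P z (fun w => f w - L K i w)) (empDev P z (L K i))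
    have h2 := hle z f hf i hi
    have h3 := (le_abs_self _).trans (hVle z i)
    linarith
  · have h1 : ∫ z, (W z + V z + 2 * (1 / 4) ^ K) ∂(Measure.pi fun _ : Fin n => P)
        = ∫ z, W z ∂(Measure.pi fun _ => P) + ∫ z, V z ∂(Measure.pi fun _ => P)
          + 2 * (1 / 4) ^ K := by
      rw [integral_add (f := fun z => W z + V z) (hW.add hV) (integrable_const _),
        integral_add hW hV, integral_const, probReal_univ, one_smul]
    rw [h1, chainBound, mul_add]
    linarith

end Chaining

/-! ### Layer-cake representation by level sets -/

section LayerCake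

open Filter Topology

theorem intervalIntegrable_step (a u v : ℝ) :
    IntervalIntegrable (fun t => if t ≤ a then (1 : ℝ) else -1) volume u v := by
  refine (AntitoneOn.intervalIntegrable fun s _ t _ hst => ?_)
  split_ifs <;> linarith

theorem integral_step {a : ℝ} (ha : a ∈ Set.Icc (-1 : ℝ) 1) :
    ∫ t in (-1 : ℝ)..1, (if t ≤ a then (1 : ℝ) else -1) = 2 * a := by
  rw [← intervalIntegral.integral_add_adjacent_intervals (b := a)
    (intervalIntegrable_step _ _ _) (intervalIntegrable_step _ _ _)]
  have h1 : ∫ t in (-1 : ℝ)..a, (if t ≤ a then (1 : ℝ) else -1) = ∫ _ in (-1 : ℝ)..a, (1 : ℝ) := by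
    refine intervalIntegral.integral_congr fun t ht => ?_
    rw [Set.uIcc_of_le ha.1] at ht
    simp [ht.2]
  have h2 : ∫ t in a..1, (if t ≤ a then (1 : ℝ) else -1) = ∫ _ in a..1, (-1 : ℝ) := by
    refine intervalIntegral.integral_congr_ae (ae_of_all _ fun t ht => ?_)
    rw [Set.uIoc_of_le ha.2] at ht
    simp [ht.1]
  rw [h1, h2]
  simp
  ring

theorem eventually_lt_iff_le {n : ℕ} (a : Fin n → ℝ) (t : ℝ) :
    ∀ᶠ s in 𝓝[<] t, ∀ i, (s < a i ↔ t ≤ a i) ∧ (s ≤ a i ↔ t ≤ a i) := by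
  refine eventually_all.2 fun i => ?_
  rcases lt_or_ge (a i) t with h | h
  · filter_upwards [Ioo_mem_nhdsLT h] with s hs
    simp only [hs.1.not_gt, h.not_ge, hs.1.not_ge, and_self]
  · filter_upwards [self_mem_nhdsWithin] with s hs
    have hs : s < t := hs
    simp only [h, hs.trans_le h, (hs.trans_le h).le, and_self]

/-- If a linear functional is at least as large at `a` as at all of its superlevel step vectors,
then it is at most as large as at the step vector of level zero. -/
theorem sum_mul_le_sum_mul_step_zero {n : ℕ} {c a : Fin n → ℝ}
    (ha : ∀ i, a i ∈ Set.Icc (-1 : ℝ) 1)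
    (h : ∀ t ∈ Set.Icc (-1 : ℝ) 1, ∑ i, c i * (if t ≤ a i then 1 else -1) ≤ ∑ i, c i * a i) :
    ∑ i, c i * a i ≤ ∑ i, c i * (if 0 ≤ a i then 1 else -1) := by
  set φ : ℝ → ℝ := fun t => ∑ i, c i * (if t ≤ a i then 1 else -1) with hφ
  set B := ∑ i, c i * a i with hB
  change B ≤ φ 0
  have hi : ∀ u v, IntervalIntegrable φ volume u v := fun u v => by
    have := IntervalIntegrable.sum Finset.univ
      fun i _ => (intervalIntegrable_step (a i) u v).const_mul (c i)
    rwa [Finset.sum_fn] at this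
  have hint : ∫ t in (-1 : ℝ)..1, φ t = 2 * B := by
    rw [hφ, intervalIntegral.integral_finsetSum
      fun i _ => (intervalIntegrable_step (a i) _ _).const_mul (c i), hB, Finset.mul_sum]
    refine Finset.sum_congr rfl fun i _ => ?_
    rw [intervalIntegral.integral_const_mul, integral_step (ha i)]
    ring
  -- Equality of averages only speaks of almost every level. With finitely many `a i`, `φ` is
  -- constant on some `(s, 0)`, so `φ 0 < B` would cost a positive amount of the integral.
  obtain ⟨s, hs, hs'⟩ := (mem_nhdsLT_iff_exists_Ioo_subset' (show (-1 : ℝ) < 0 by norm_num)).1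
    (inter_mem (eventually_lt_iff_le a 0) (Ioo_mem_nhdsLT (show (-1 : ℝ) < 0 by norm_num)))
  have hs0 : s < 0 := hs
  have hs1 : -1 ≤ s := by
    by_contra! hlt
    exact absurd (hs' (show (-1 : ℝ) ∈ Set.Ioo s 0 from ⟨hlt, by norm_num⟩)).2.1 (lt_irrefl _)
  have hconst : ∀ t ∈ Set.Ioo s 0, φ t = φ 0 := fun t ht => by
    have := (hs' ht).1
    simp only [hφ]
    exact Finset.sum_congr rfl fun i _ => by simp only [(this i).2]
  have hle : ∀ u v : ℝ, -1 ≤ u → u ≤ v → v ≤ 1 → ∫ t in u..v, φ t ≤ (v - u) * B := by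
    intro u v hu huv hv
    calc ∫ t in u..v, φ t ≤ ∫ _ in u..v, B :=
          intervalIntegral.integral_mono_on huv (hi u v) intervalIntegrable_const
            fun t ht => h t ⟨hu.trans ht.1, ht.2.trans hv⟩
      _ = (v - u) * B := by simp
  have hmid : ∫ t in s..0, φ t ≤ (0 - s) * φ 0 := by
    calc ∫ t in s..0, φ t ≤ ∫ _ in s..0, φ 0 :=
          intervalIntegral.integral_mono_on_of_le_Ioo hs0.le (hi s 0) intervalIntegrable_const
            fun t ht => (hconst t ht).le
      _ = (0 - s) * φ 0 := by simp
  rw [← intervalIntegral.integral_add_adjacent_intervals (hi (-1) s) (hi s 1),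
    ← intervalIntegral.integral_add_adjacent_intervals (hi s 0) (hi 0 1)] at hint
  have h1 := hle (-1) s le_rfl hs1 (by linarith)
  have h2 := hle 0 1 (by norm_num) (by norm_num) le_rfl
  by_contra! hlt
  nlinarith

end LayerCake

/-! ### From hinge risk to classification risk -/

section EmpiricalRisk

variable {𝒳 : Type u}

/-- The labelled step classifier `(y, x) ↦ y * (2 * 1{x ∈ G} - 1)`. -/
noncomputable def labelledStep (G : Set 𝒳) : Label × 𝒳 → ℝ :=
  fun z => (z.1 : ℝ) * stepClassifier G z.2

theorem label_eq (y : Label) : (y : ℝ) = -1 ∨ (y : ℝ) = 1 := y.2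

theorem stepClassifier_setOf (p : 𝒳 → Prop) [DecidablePred p] (x : 𝒳) :
    stepClassifier {x | p x} x = if p x then 1 else -1 := by
  by_cases h : p x <;> simp [stepClassifier, indicatorFn, h]
  norm_num

theorem stepClassifier_eq_or (G : Set 𝒳) (x : 𝒳) :
    stepClassifier G x = -1 ∨ stepClassifier G x = 1 := by
  by_cases h : x ∈ G <;> simp [stepClassifier, indicatorFn, h]
  norm_num

theorem abs_labelledStep (G : Set 𝒳) (z : Label × 𝒳) : |labelledStep G z| = 1 := by
  rw [labelledStep, abs_mul]
  rcases label_eq z.1 with h | h <;> rcases stepClassifier_eq_or G z.2 with h' | h' <;>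
    simp [h, h']

theorem empiricalHingeRisk_eq {n : ℕ} (z : Fin n → Label × 𝒳) {f : 𝒳 → ℝ}
    (hf : ∀ x, f x ∈ Set.Icc (-1 : ℝ) 1) :
    empiricalHingeRisk z f = (1 / (n : ℝ)) * (n - ∑ i, ((z i).1 : ℝ) * f (z i).2) := by
  have h : ∀ i, max 0 (1 - ((z i).1 : ℝ) * f (z i).2) = 1 - ((z i).1 : ℝ) * f (z i).2 := by
    intro i
    refine max_eq_right ?_
    obtain ⟨h1, h2⟩ := hf (z i).2
    rcases label_eq (z i).1 with h | h <;> rw [h] <;> linarith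
  simp [empiricalHingeRisk, h]

/-- If the step classifiers of `𝒢` belong to `F`, whose sublevel sets belong to `𝒢`, then the
strict superlevel sets of `F` belong to `𝒢` as well. -/
theorem setOf_lt_mem {𝒢 : Set (Set 𝒳)} {F : Set (𝒳 → ℝ)}
    (hsub : ∀ f ∈ F, ∀ t ∈ Set.Icc (-1 : ℝ) 1, {x | f x ≤ t} ∈ 𝒢)
    (hstep : ∀ G ∈ 𝒢, stepClassifier G ∈ F) {f : 𝒳 → ℝ} (hf : f ∈ F) {t : ℝ}
    (ht : t ∈ Set.Icc (-1 : ℝ) 1) : {x | t < f x} ∈ 𝒢 := by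
  -- The sublevel set at `0` of the step classifier of `{f ≤ t}` is the complement of `{f ≤ t}`.
  have h := hsub _ (hstep _ (hsub f hf t ht)) 0 (by norm_num)
  convert h using 1
  ext x
  simp only [Set.mem_ofPred_eq, stepClassifier_setOf (fun x => f x ≤ t) x, ← not_le]
  split_ifs with h <;> simp [h]

/-- The prediction set of a minimizer of the empirical hinge risk minimizes the empirical
classification risk over `𝒢`. -/
theorem sum_labelledStep_le {𝒢 : Set (Set 𝒳)} {F : Set (𝒳 → ℝ)} (hF : F ⊆ constrainedClass 𝒢)
    (hlevel : (∀ f ∈ F, ∀ t ∈ Set.Icc (-1 : ℝ) 1, {x | t ≤ f x} ∈ 𝒢) ∨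
      (∀ f ∈ F, ∀ t ∈ Set.Icc (-1 : ℝ) 1, {x | f x ≤ t} ∈ 𝒢))
    (hstep : ∀ G ∈ 𝒢, stepClassifier G ∈ F) {n : ℕ} (hn : 1 ≤ n) (z : Fin n → Label × 𝒳)
    {f : 𝒳 → ℝ} (hf : f ∈ F)
    (hmin : ∀ g ∈ F, empiricalHingeRisk z f ≤ empiricalHingeRisk z g) {G : Set 𝒳} (hG : G ∈ 𝒢) :
    ∑ i, labelledStep G (z i) ≤ ∑ i, labelledStep (predictionSet f) (z i) := by
  have hopt : ∀ G ∈ 𝒢, ∑ i, labelledStep G (z i) ≤ ∑ i, ((z i).1 : ℝ) * f (z i).2 := by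
    intro G hG
    have h := hmin _ (hstep G hG)
    rw [empiricalHingeRisk_eq z (hF hf).2, empiricalHingeRisk_eq z (hF (hstep G hG)).2] at h
    have := le_of_mul_le_mul_left h (by positivity)
    simp only [labelledStep]
    linarith
  refine (hopt G hG).trans ?_
  have key := sum_mul_le_sum_mul_step_zero (c := fun i => ((z i).1 : ℝ))
    (a := fun i => f (z i).2) (fun i => (hF hf).2 _) ?_
  · simpa only [labelledStep, predictionSet, stepClassifier_setOf (fun x => 0 ≤ f x)] using key
  · intro t ht
    rcases hlevel with hsup | hsub
    · simpa only [labelledStep, stepClassifier_setOf (fun x => t ≤ f x)] using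
        hopt _ (hsup f hf t ht)
    -- Here `{t ≤ f}` may lie outside `𝒢`, but on the sample it agrees with `{s < f}` for `s`
    -- slightly below `t`. At `t = -1` there is no such `s` in `[-1, 1]`, and the whole space `{f ≤
    -- 1}` is used.
    · rcases ht.1.eq_or_lt with rfl | ht1
      · have huniv : {x | f x ≤ 1} ∈ 𝒢 := hsub f hf 1 (by norm_num)
        have := hopt _ huniv
        simp only [labelledStep, stepClassifier_setOf (fun x => f x ≤ 1)] at this
        simpa only [((hF hf).2 _).1, ((hF hf).2 _).2, if_true] using this
      · obtain ⟨s, hs, hs'⟩ := ((eventually_lt_iff_le (fun i => f (z i).2) t).and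
          (Ioo_mem_nhdsLT ht1)).exists
        have := hopt _ (setOf_lt_mem hsub hstep hf (t := s) ⟨hs'.1.le, hs'.2.le.trans ht.2⟩)
        simp only [labelledStep, stepClassifier_setOf (fun x => s < f x)] at this
        simpa only [fun i => (hs i).1] using this

variable [MeasurableSpace 𝒳]

theorem measurable_stepClassifier {G : Set 𝒳} (hG : MeasurableSet G) :
    Measurable (stepClassifier G) :=
  ((measurable_const.indicator hG).const_mul 2).sub_const 1

theorem measurable_labelledStep {G : Set 𝒳} (hG : MeasurableSet G) :
    Measurable (labelledStep G) :=
  (measurable_subtype_coe.comp measurable_fst).mul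
    ((measurable_stepClassifier hG).comp measurable_snd)

theorem risk_eq {P : Measure (Label × 𝒳)} [IsProbabilityMeasure P] {f : 𝒳 → ℝ}
    (hf : MeasurableSet (predictionSet f)) :
    risk P f = (1 - ∫ z, labelledStep (predictionSet f) z ∂P) / 2 := by
  have hsgn : ∀ z : Label × 𝒳, (z.1 : ℝ) * sgn (f z.2) = labelledStep (predictionSet f) z :=
    fun z => by rw [labelledStep, predictionSet, stepClassifier_setOf (fun x => 0 ≤ f x), sgn]
  have hint : Integrable (labelledStep (predictionSet f)) P :=
    integrable_of_abs_le (measurable_labelledStep hf) fun z => (abs_labelledStep _ z).le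
  have hs : MeasurableSet {z : Label × 𝒳 | labelledStep (predictionSet f) z ≤ 0} :=
    measurableSet_le (measurable_labelledStep hf) measurable_const
  simp only [risk, hsgn]
  rw [← integral_indicator_one hs, eq_div_iff two_ne_zero, mul_comm, ← integral_const_mul]
  calc _ = ∫ z, (1 - labelledStep (predictionSet f) z) ∂P := by
        congr 1
        ext z
        rcases eq_or_eq_neg_of_abs_eq (abs_labelledStep (predictionSet f) z) with h | h <;>
          simp [h]
        norm_num
    _ = _ := by rw [integral_sub (integrable_const _) hint]; simp

/-- The risk is half of `1` minus a mean, so the two deviations, each at most `W`, add up to `W` and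
not `2 * W`. -/
theorem risk_sub_risk_le {P : Measure (Label × 𝒳)} [IsProbabilityMeasure P] {n : ℕ}
    (z : Fin n → Label × 𝒳) {f g : 𝒳 → ℝ}
    (hf : MeasurableSet (predictionSet f)) (hg : MeasurableSet (predictionSet g)) {W : ℝ}
    (hle : ∑ i, labelledStep (predictionSet g) (z i) ≤ ∑ i, labelledStep (predictionSet f) (z i))
    (hfW : |empDev P z (labelledStep (predictionSet f))| ≤ W)
    (hgW : |empDev P z (labelledStep (predictionSet g))| ≤ W) : risk P f - risk P g ≤ W := by
  rw [risk_eq hf, risk_eq hg]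
  have h := mul_le_mul_of_nonneg_left hle (by positivity : (0 : ℝ) ≤ 1 / n)
  have h1 := (abs_le.1 hfW).2
  have h2 := (abs_le.1 hgW).1
  simp only [empDev] at h1 h2
  linarith

end EmpiricalRisk

/-! ### Brackets for the labelled step classifiers -/

section Brackets

/-- The projection of `ℝ` onto `[-1, 1]`. -/
noncomputable def clip (a : ℝ) : ℝ := max (-1) (min 1 a)

theorem abs_clip_le (a : ℝ) : |clip a| ≤ 1 :=
  abs_le.2 ⟨le_max_left _ _, max_le (by norm_num) (min_le_left _ _)⟩

theorem clip_mono {a b : ℝ} (h : a ≤ b) : clip a ≤ clip b :=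
  max_le_max le_rfl (min_le_min le_rfl h)

theorem clip_sub_clip_le {a b : ℝ} (h : a ≤ b) : clip b - clip a ≤ b - a := by
  unfold clip
  rcases max_cases (-1 : ℝ) (min 1 a) with ⟨h1, _⟩ | ⟨h1, _⟩ <;>
    rcases max_cases (-1 : ℝ) (min 1 b) with ⟨h2, _⟩ | ⟨h2, _⟩ <;>
    rcases min_cases (1 : ℝ) a with ⟨h3, _⟩ | ⟨h3, _⟩ <;>
    rcases min_cases (1 : ℝ) b with ⟨h4, _⟩ | ⟨h4, _⟩ <;> linarith

variable {𝒳 : Type u}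

theorem clip_stepClassifier (G : Set 𝒳) (x : 𝒳) :
    clip (stepClassifier G x) = stepClassifier G x := by
  rcases stepClassifier_eq_or G x with h | h <;> rw [h] <;> norm_num [clip]

variable [MeasurableSpace 𝒳]

theorem exists_hasBracketCover {p : ℝ≥0∞} {ε : ℝ} {F : Set (𝒳 → ℝ)} {Q : Measure 𝒳} {c : ℝ}
    (h : bracketingEntropy p ε F Q ≤ (c : EReal)) :
    ∃ k : ℕ, HasBracketCover p ε F Q k ∧ (k : ℝ) ≤ Real.exp c := by
  have h1 : ((bracketingNumber p ε F Q : ℕ∞) : ℝ≥0∞) ≤ ENNReal.ofReal (Real.exp c) := by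
    rw [← EReal.exp_coe, ← ENNReal.exp_log ((bracketingNumber p ε F Q : ℕ∞) : ℝ≥0∞)]
    exact EReal.exp_monotone h
  obtain ⟨m, hm⟩ := ENat.ne_top_iff_exists.1 (show bracketingNumber p ε F Q ≠ ⊤ by
    intro htop
    rw [htop] at h1
    simp at h1)
  have hlt : bracketingNumber p ε F Q < ((m + 1 : ℕ) : ℕ∞) := by
    rw [← hm]; exact_mod_cast Nat.lt_succ_self m
  simp only [bracketingNumber, iInf_lt_iff] at hlt
  obtain ⟨k, hk, hkm⟩ := hlt
  refine ⟨k, hk, ?_⟩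
  have hkm : k ≤ m := Nat.lt_succ_iff.1 (by exact_mod_cast hkm)
  rw [← hm] at h1
  have h2 : (m : ℝ) ≤ Real.exp c := by
    have h3 := ENNReal.toReal_mono ENNReal.ofReal_ne_top h1
    simpa [ENNReal.toReal_ofReal (Real.exp_pos c).le] using h3
  exact le_trans (by exact_mod_cast hkm) h2

theorem HasBracketCover.mono {p : ℝ≥0∞} {ε : ℝ} {F F' : Set (𝒳 → ℝ)} {Q : Measure 𝒳} {k : ℕ}
    (h : HasBracketCover p ε F Q k) (hF : F' ⊆ F) : HasBracketCover p ε F' Q k := by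
  obtain ⟨l, u, hlu, hcov⟩ := h
  exact ⟨l, u, hlu, fun f hf => hcov f (hF hf)⟩

theorem HasBracketCover.stepClassifier {p : ℝ≥0∞} {ε : ℝ} {𝒢 : Set (Set 𝒳)} {Q : Measure 𝒳}
    {k : ℕ} (h : HasBracketCover p (ε / 2) (indicatorFn '' 𝒢) Q k) :
    HasBracketCover p ε (stepClassifier '' 𝒢) Q k := by
  obtain ⟨l, u, hlu, hcov⟩ := h
  refine ⟨fun j x => 2 * l j x - 1, fun j x => 2 * u j x - 1, fun j => ?_, ?_⟩
  · obtain ⟨hl, hu, hle, hsize⟩ := hlu j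
    refine ⟨by fun_prop, by fun_prop, fun x => by linarith [hle x], ?_⟩
    have e : ((fun x => 2 * u j x - 1) - fun x => 2 * l j x - 1) = (2 : ℝ) • (u j - l j) := by
      ext x
      simp only [Pi.sub_apply, Pi.smul_apply, smul_eq_mul]
      ring
    have e2 : ENNReal.ofReal ε = ENNReal.ofReal 2 * ENNReal.ofReal (ε / 2) := by
      rw [← ENNReal.ofReal_mul (by norm_num)]
      congr 1
      ring
    rw [e, eLpNorm_const_smul, e2, Real.enorm_of_nonneg (by norm_num : (0 : ℝ) ≤ 2)]
    exact ENNReal.mul_lt_mul_right (by simp) (by simp) hsize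
  · rintro _ ⟨G, hG, rfl⟩
    obtain ⟨j, hj1, hj2⟩ := hcov _ ⟨G, hG, rfl⟩
    exact ⟨j, fun x => by simp only [ConstrainedClassification.stepClassifier]; linarith [hj1 x],
      fun x => by simp only [ConstrainedClassification.stepClassifier]; linarith [hj2 x]⟩

/-- Brackets of the step classifiers give brackets of the labelled step classifiers. -/
theorem HasBracketCover.exists_isBracketing {P : Measure (Label × 𝒳)} [IsProbabilityMeasure P]
    {ε : ℝ} (hε : 0 ≤ ε) {𝒢 : Set (Set 𝒳)} {k : ℕ}
    (h : HasBracketCover 1 ε (ConstrainedClassification.stepClassifier '' 𝒢) P.snd k) :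
    ∃ L U : Fin k → Label × 𝒳 → ℝ, IsBracketing P (labelledStep '' 𝒢) ε L U := by
  obtain ⟨l, u, hlu, hcov⟩ := h
  -- The label `-1` reverses the order of the bracket, hence `min` and `max`; clipping makes the end
  -- points bounded without enlarging the bracket.
  refine ⟨fun j z => min (z.1 * clip (l j z.2)) (z.1 * clip (u j z.2)),
    fun j z => max (z.1 * clip (l j z.2)) (z.1 * clip (u j z.2)), fun j => ?_, ?_⟩
  · obtain ⟨hl, hu, hle, hsize⟩ := hlu j
    have hclip : Measurable clip := measurable_const.max (measurable_const.min measurable_id)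
    have hy : Measurable fun z : Label × 𝒳 => (z.1 : ℝ) :=
      measurable_subtype_coe.comp measurable_fst
    have hl' : Measurable fun z : Label × 𝒳 => (z.1 : ℝ) * clip (l j z.2) :=
      hy.mul (hclip.comp (hl.comp measurable_snd))
    have hu' : Measurable fun z : Label × 𝒳 => (z.1 : ℝ) * clip (u j z.2) :=
      hy.mul (hclip.comp (hu.comp measurable_snd))
    refine ⟨hl'.min hu', hl'.max hu', fun z => ?_, ?_⟩
    · have h1 := abs_le.1 (abs_clip_le (l j z.2))
      have h2 := abs_le.1 (abs_clip_le (u j z.2))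
      refine ⟨abs_le.2 ⟨le_min ?_ ?_, (min_le_left _ _).trans ?_⟩,
        abs_le.2 ⟨le_trans ?_ (le_max_left _ _), max_le ?_ ?_⟩, min_le_max⟩ <;>
      rcases label_eq z.1 with h | h <;> rw [h] <;> linarith
    · have e : ∀ z : Label × 𝒳, max ((z.1 : ℝ) * clip (l j z.2)) (z.1 * clip (u j z.2))
          - min ((z.1 : ℝ) * clip (l j z.2)) (z.1 * clip (u j z.2))
          = clip (u j z.2) - clip (l j z.2) := fun z => by
        rw [max_sub_min_eq_abs]
        have h0 := clip_mono (hle z.2)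
        rcases label_eq z.1 with h | h <;> rw [h]
        · rw [abs_of_nonpos] <;> linarith
        · rw [abs_of_nonneg] <;> linarith
      simp_rw [e]
      have hsz : ∫⁻ x, ‖(u j - l j) x‖ₑ ∂P.snd < ENNReal.ofReal ε := by
        rwa [← eLpNorm_one_eq_lintegral_enorm]
      rw [Measure.snd, lintegral_map (by fun_prop) measurable_snd] at hsz
      have hm : Measurable fun z : Label × 𝒳 => clip (u j z.2) - clip (l j z.2) :=
        (hclip.comp (hu.comp measurable_snd)).sub (hclip.comp (hl.comp measurable_snd))
      rw [integral_eq_lintegral_of_nonneg_ae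
        (ae_of_all _ fun z : Label × 𝒳 => sub_nonneg.2 (clip_mono (hle z.2)))
        hm.aestronglyMeasurable]
      refine ENNReal.toReal_le_of_le_ofReal hε (le_trans (lintegral_mono fun z => ?_) hsz.le)
      rw [Pi.sub_apply, Real.enorm_of_nonneg (sub_nonneg.2 (hle z.2))]
      exact ENNReal.ofReal_le_ofReal (clip_sub_clip_le (hle z.2))
  · rintro _ ⟨G, hG, rfl⟩
    obtain ⟨j, hj1, hj2⟩ := hcov _ ⟨G, hG, rfl⟩
    refine ⟨j, fun z => ?_⟩
    have h1 := clip_mono (hj1 z.2)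
    have h2 := clip_mono (hj2 z.2)
    rw [clip_stepClassifier] at h1 h2
    rw [labelledStep, min_le_iff, le_max_iff]
    rcases label_eq z.1 with h | h <;> rw [h]
    · exact ⟨Or.inr (by linarith), Or.inl (by linarith)⟩
    · exact ⟨Or.inl (by linarith), Or.inr (by linarith)⟩

theorem one_fourth_pow_rpow_neg (r : ℝ) (k : ℕ) :
    ((1 / 4 : ℝ) ^ k) ^ (-r) = (((2 : ℝ) ^ r) ^ k) ^ 2 := by
  rw [Real.rpow_neg (by positivity), ← Real.inv_rpow (by positivity), ← pow_mul,
    Real.rpow_pow_comm (by norm_num), mul_comm, pow_mul]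
  congr 1
  rw [← inv_pow]
  norm_num

/-- Either entropy condition gives brackets of the labelled step classifiers. -/
theorem exists_isBracketing_labelledStep {C r : ℝ} (hC : 0 < C) (hr : 0 < r) {𝒢 : Set (Set 𝒳)}
    {F : Set (𝒳 → ℝ)} (hstep : ∀ G ∈ 𝒢, stepClassifier G ∈ F) {P : Measure (Label × 𝒳)}
    [IsProbabilityMeasure P]
    (hent : (∀ ε : ℝ, 0 < ε →
        bracketingEntropySets 1 ε 𝒢 P.snd ≤ ((C * ε ^ (-r) : ℝ) : EReal)) ∨
      (∀ ε : ℝ, 0 < ε → bracketingEntropy 1 ε F P.snd ≤ ((C * ε ^ (-r) : ℝ) : EReal)))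
    (k : ℕ) :
    ∃ (N : ℕ) (L U : Fin N → Label × 𝒳 → ℝ),
      IsBracketing P (labelledStep '' 𝒢) ((1 / 4) ^ k) L U ∧
      (N : ℝ) ≤ Real.exp (C * 2 ^ r * (((2 : ℝ) ^ r) ^ k) ^ 2) := by
  have hx : (1 : ℝ) ≤ 2 ^ r := Real.one_le_rpow (by norm_num) hr.le
  have hk : (0 : ℝ) < (1 / 4) ^ k := by positivity
  rcases hent with h | h
  -- Passing from `1{x ∈ G}` to `2 * 1{x ∈ G} - 1` doubles bracket sizes; halving the scale costs
  -- the factor `2 ^ r` in the entropy.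
  · obtain ⟨N, hN, hNle⟩ := exists_hasBracketCover (h ((1 / 4) ^ k / 2) (by positivity))
    obtain ⟨L, U, hLU⟩ := hN.stepClassifier.exists_isBracketing hk.le
    refine ⟨N, L, U, hLU, hNle.trans_eq ?_⟩
    rw [Real.div_rpow hk.le (by norm_num), one_fourth_pow_rpow_neg,
      Real.rpow_neg (by norm_num : (0 : ℝ) ≤ 2), div_inv_eq_mul]
    congr 1
    ring
  · obtain ⟨N, hN, hNle⟩ := exists_hasBracketCover (h ((1 / 4) ^ k) hk)
    obtain ⟨L, U, hLU⟩ := (hN.mono (by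
      rintro _ ⟨G, hG, rfl⟩; exact hstep G hG)).exists_isBracketing hk.le
    refine ⟨N, L, U, hLU, hNle.trans (Real.exp_le_exp.2 ?_)⟩
    rw [one_fourth_pow_rpow_neg]
    gcongr
    exact le_mul_of_one_le_right hC.le hx

end Brackets
end ConstrainedClassification

/-! ### The risk bound -/

theorem theorem4 (C r : ℝ) (hC : 0 < C) (hr : 0 < r) :
    ∃ D₁ D₂ D₃ D₄ : ℝ, 0 < D₁ ∧ 0 < D₂ ∧ 0 < D₃ ∧ 0 < D₄ ∧
      ∀ (𝒳 : Type u) [MeasurableSpace 𝒳]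
        (𝒢 : Set (Set 𝒳)) (F : Set (𝒳 → ℝ)) (Ps : Set (Measure (Label × 𝒳))),
        (∀ G ∈ 𝒢, MeasurableSet G) →
        (∀ P ∈ Ps, IsProbabilityMeasure P) →
        F ⊆ constrainedClass 𝒢 →
        -- (A1), for superlevel sets or for sublevel sets
        ((∀ f ∈ F, ∀ t ∈ Set.Icc (-1 : ℝ) 1, {x | t ≤ f x} ∈ 𝒢) ∨
          (∀ f ∈ F, ∀ t ∈ Set.Icc (-1 : ℝ) 1, {x | f x ≤ t} ∈ 𝒢)) →
        -- (A2)
        (∀ G ∈ 𝒢, stepClassifier G ∈ F) →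
        -- the entropy condition, for the class of sets or for the class of classifiers
        ((∀ P ∈ Ps, ∀ ε : ℝ, 0 < ε →
            bracketingEntropySets 1 ε 𝒢 P.snd ≤ ((C * ε ^ (-r) : ℝ) : EReal)) ∨
          (∀ P ∈ Ps, ∀ ε : ℝ, 0 < ε →
            bracketingEntropy 1 ε F P.snd ≤ ((C * ε ^ (-r) : ℝ) : EReal))) →
        ∀ n : ℕ, 1 ≤ n →
        ∀ fhat : (Fin n → Label × 𝒳) → (𝒳 → ℝ),
          -- `fhat` minimizes the empirical hinge risk over `F`
          (∀ z, fhat z ∈ F ∧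
            ∀ f ∈ F, empiricalHingeRisk z (fhat z) ≤ empiricalHingeRisk z f) →
          ∀ P ∈ Ps,
            -- the risk of `fhat` is a random variable
            AEStronglyMeasurable (fun z => risk P (fhat z)) (sampleLaw P n) →
            Integrable (fun z => excessRisk P 𝒢 (fhat z)) (sampleLaw P n) ∧
            ∫ z, excessRisk P 𝒢 (fhat z) ∂(sampleLaw P n)
              ≤ riskBound D₁ D₂ D₃ D₄ r n := by
  have hx : (1 : ℝ) ≤ 2 ^ r := Real.one_le_rpow (by norm_num) hr.le
  have hC' : 0 < C * 2 ^ r := by positivity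
  obtain ⟨D, hD, hrate⟩ :=
    exists_chainBound_le_rateTau (A := 8 * (C * 2 ^ r) + 7) (by positivity) hr
  -- The expectation is bounded by `D * rateTau r n` directly, so the `D₂` and `D₄` terms are slack,
  -- except at `r = 1`, `n = 1`.
  refine ⟨D, 1, D, 1, hD, one_pos, hD, one_pos, ?_⟩
  intro 𝒳 _ 𝒢 F Ps h𝒢 hPs hF hlevel hstep hent n hn fhat hfhat P hP hmeas
  have := hPs P hP
  have hprob : IsProbabilityMeasure (sampleLaw P n) := by unfold sampleLaw; infer_instance
  have hrisk0 : ∀ f : 𝒳 → ℝ, 0 ≤ risk P f := fun f => measureReal_nonneg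
  have hrisk1 : ∀ f : 𝒳 → ℝ, risk P f ≤ 1 := fun f => measureReal_le_one
  have hint : Integrable (fun z => excessRisk P 𝒢 (fhat z)) (sampleLaw P n) :=
    (Integrable.of_bound hmeas 1 (ae_of_all _ fun z => by
      rw [Real.norm_of_nonneg (hrisk0 _)]; exact hrisk1 _)).sub (integrable_const _)
  refine ⟨hint, ?_⟩
  by_cases hrn : r ≠ 1 ∨ 2 ≤ n
  · obtain ⟨K, hK, hbound⟩ := hrate n hn hrn
    choose N L U hLU hN using exists_isBracketing_labelledStep hC hr hstep
      (hent.imp (fun h => h P hP) (fun h => h P hP))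
    obtain ⟨W, hW, hle, hWint⟩ := exists_majorant_class (P := P)
      (by rintro _ ⟨G, hG, rfl⟩; exact measurable_labelledStep (h𝒢 G hG)) hn hC' hx hK hLU hN
    have hexc : ∀ z, excessRisk P 𝒢 (fhat z) ≤ W z := by
      intro z
      obtain ⟨hz, hmin⟩ := hfhat z
      have hfG := (hF hz).1
      have hinf : risk P (fhat z) - W z ≤ optimalRisk P 𝒢 := by
        refine le_csInf ⟨_, Set.mem_image_of_mem _ (hF hz)⟩ ?_
        rintro _ ⟨g, hg, rfl⟩
        have := risk_sub_risk_le (P := P) z (h𝒢 _ hfG) (h𝒢 _ hg.1)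
          (sum_labelledStep_le hF hlevel hstep hn z hz hmin hg.1)
          (hle z _ ⟨_, hfG, rfl⟩) (hle z _ ⟨_, hg.1, rfl⟩)
        linarith
      rw [excessRisk]
      linarith
    have hmain : ∫ z, excessRisk P 𝒢 (fhat z) ∂(sampleLaw P n) ≤ D * rateTau r n :=
      (integral_mono hint hW hexc).trans (hWint.trans hbound)
    have htau : 0 ≤ D * rateTau r n := by
      refine mul_nonneg hD.le ?_
      unfold rateTau
      split_ifs <;> positivity
    have hn0 : (0 : ℝ) ≤ (n : ℝ)⁻¹ := by positivity
    unfold riskBound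
    split_ifs
    · linarith [Real.exp_pos (-(D ^ 2 * rateQ r n ^ 2))]
    · linarith
  -- Now `r = 1` and `n = 1`, so `τ_n = 0`; the exponential term equals `4` and exceeds the trivial
  -- bound `1`.
  · push Not at hrn
    obtain ⟨rfl, hn2⟩ := hrn
    obtain rfl : n = 1 := by omega
    have hopt : 0 ≤ optimalRisk P 𝒢 := by
      refine Real.sInf_nonneg ?_
      rintro _ ⟨g, -, rfl⟩
      exact hrisk0 g
    calc ∫ z, excessRisk P 𝒢 (fhat z) ∂(sampleLaw P 1) ≤ ∫ _, (1 : ℝ) ∂(sampleLaw P 1) :=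
          integral_mono hint (integrable_const _) fun z => by
            change risk P (fhat z) - optimalRisk P 𝒢 ≤ 1
            linarith [hrisk1 (fhat z)]
      _ = 1 := by simp
      _ ≤ riskBound D 1 D 1 1 1 := by
        norm_num [riskBound, rateQ, rateTau]
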